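/- Let $(\mathcal{E},\mathcal{S})$ be an exact category in the sense of Quillen: an additive category with a class $\mathcal{S}$ of kernel-cokernel pairs $A\to B\to C$ (the conflations; the first map is called an inflation with cone $C$) satisfying Quillen's axioms. Let $\mathcal{X}$ be a semibrick in $\mathcal{E}$, i.e. a class of objects (up to isomorphism) such that $\operatorname{End}(X)$ is a division ring for every $X\in\mathcal{X}$ and $\operatorname{Hom}(X,X')=0$ for any non-isomorphic $X,X'\in\mathcal{X}$. For a class $\mathcal{Y}$ of objects in a category with conflations, a $\mathcal{Y}$-filtration of length $n\ge 0$ of an object $M$ is a sequence of inflations $0=M_0\to M_1\to\cdots\to M_n=M$ whose cones belong to $\mathcal{Y}$ up to isomorphism. $\operatorname{Filt}(\mathcal{Y})$ is the full subcategory of objects admitting a $\mathcal{Y}$-filtration, and $\ell_{\mathcal{Y}}(M)$ is the minimal length of a $\mathcal{Y}$-filtration of $M\in\operatorname{Filt}(\mathcal{Y})$. The category satisfies the Jordan-Hölder property (JHP) if there is a class $\mathcal{Y}$ of its objects such that (1) every object has a $\mathcal{Y}$-filtration; (2) for every object $M$, any two $\mathcal{Y}$-filtrations of $M$ of length $\ell_{\mathcal{Y}}(M)$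 have the same sequence of cones up to permutation and isomorphism; (3) for every object $M$, all $\mathcal{Y}$-filtrations of $M$ have the same length. Then $\mathcal{X}$ is proper, i.e. there is no conflation $X\to 0\to N$ with $X\in\mathcal{X}$ and $N\in\operatorname{Filt}_{\mathcal{E}}(\mathcal{X})$; and the full subcategory $\mathcal{T}=\operatorname{Filt}_{\mathcal{E}}(\mathcal{X})$, whose conflations are the conflations of $\mathcal{E}$ with all three terms in $\mathcal{T}$, satisfies (JHP). -/

import Mathlib

open CategoryTheory CategoryTheory.Limits

universe v u

namespace SemibrickJHP

/-! ### Exact categories -/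

section Exact

variable {C : Type u} [Category.{v} C] [Preadditive C]

/-- A kernel-cokernel pair: `S.f` is a kernel of `S.g` and `S.g` is a cokernel of `S.f`. -/
def IsKernelCokernelPair (S : ShortComplex C) : Prop :=
  Nonempty (IsLimit (KernelFork.ofι S.f S.zero)) ∧
    Nonempty (IsColimit (CokernelCofork.ofπ S.g S.zero))

/-- `i` is an inflation for the class `conf` of conflations: it is the first map of a conflation. -/
def IsInflation (conf : ObjectProperty (ShortComplex C)) {A B : C} (i : A ⟶ B) : Prop :=
  ∃ (D : C) (p : B ⟶ D) (w : i ≫ p = 0), conf (ShortComplex.mk i p w)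

/-- `p` is a deflation for the class `conf` of conflations: it is the second map of a
conflation. -/
def IsDeflation (conf : ObjectProperty (ShortComplex C)) {B D : C} (p : B ⟶ D) : Prop :=
  ∃ (A : C) (i : A ⟶ B) (w : i ≫ p = 0), conf (ShortComplex.mk i p w)

variable (C) in
/-- An exact structure (in the sense of Quillen) on the category `C`; for `C` additive, the pair
is an exact category. -/
structure ExactStructure where
  /-- the class of conflations -/
  conflation : ObjectProperty (ShortComplex C)
  of_iso : ∀ {S T : ShortComplex C}, (S ≅ T) → conflation S → conflation T
  isKernelCokernelPair : ∀ {S : ShortComplex C}, conflation S → IsKernelCokernelPair S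
  inflation_id : ∀ A : C, IsInflation conflation (𝟙 A)
  deflation_id : ∀ A : C, IsDeflation conflation (𝟙 A)
  inflation_comp : ∀ {A B D : C} (i : A ⟶ B) (j : B ⟶ D),
    IsInflation conflation i → IsInflation conflation j → IsInflation conflation (i ≫ j)
  deflation_comp : ∀ {A B D : C} (p : A ⟶ B) (q : B ⟶ D),
    IsDeflation conflation p → IsDeflation conflation q → IsDeflation conflation (p ≫ q)
  /-- pushouts of inflations along arbitrary morphisms exist and are inflations -/
  inflation_pushout : ∀ {A B A' : C} (i : A ⟶ B) (a : A ⟶ A'), IsInflation conflation i →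
    ∃ (B' : C) (b : B ⟶ B') (i' : A' ⟶ B'), IsPushout i a b i' ∧ IsInflation conflation i'
  /-- pullbacks of deflations along arbitrary morphisms exist and are deflations -/
  deflation_pullback : ∀ {B D D' : C} (p : B ⟶ D) (d : D' ⟶ D), IsDeflation conflation p →
    ∃ (B' : C) (b : B' ⟶ B) (p' : B' ⟶ D'), IsPullback b p' p d ∧ IsDeflation conflation p'

/-- The conflations of a full subcategory `T`: the sequences in `T` which are conflations in the
ambient category. -/
def inducedConflation (conf : ObjectProperty (ShortComplex C)) (T : ObjectProperty C) :
    ObjectProperty (ShortComplex T.FullSubcategory) :=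
  fun S => conf (S.map T.ι)

end Exact

/-! ### Filtrations and the Jordan-Hölder property

These notions depend only on the class of conflations. -/

section Filtration

variable {C : Type u} [Category.{v} C] [Preadditive C]
  (conf : ObjectProperty (ShortComplex C)) (X : ObjectProperty C)

/-- `HasFiltration conf X l M` means that there is a filtration
`0 = M₀ ⟶ M₁ ⟶ ⋯ ⟶ Mₙ = M` by inflations whose cones lie in `X`, with `l` the list of these cones,
written from the top (the cone of `Mₙ₋₁ ⟶ Mₙ`) to the bottom (the cone of `M₀ ⟶ M₁`).
The length of the filtration is `l.length`. -/
inductive HasFiltration : List C → C → Prop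
  | zero {M : C} (hM : IsZero M) : HasFiltration [] M
  | step {l : List C} {M' M Y : C} (i : M' ⟶ M) (p : M ⟶ Y) (w : i ≫ p = 0)
      (h : conf (ShortComplex.mk i p w)) (hY : X Y) (hM' : HasFiltration l M') :
      HasFiltration (Y :: l) M

/-- The filtration subcategory generated by `X`: the objects which admit an `X`-filtration. -/
def Filt : ObjectProperty C :=
  fun M => ∃ l : List C, HasFiltration conf X l M

/-- The `X`-length of `M`: the minimal length of the `X`-filtrations of `M`
(used only for objects that have one). -/
noncomputable def filtLength (M : C) : ℕ :=
  sInf {n : ℕ | ∃ l : List C, HasFiltration conf X l M ∧ l.length = n}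

/-- Two finite sequences of objects are isomorphic if they agree, up to isomorphism of the terms,
after a permutation of the indices (in particular they have the same length). -/
def SeqIso (l l' : List C) : Prop :=
  ∃ σ : Fin l.length ≃ Fin l'.length, ∀ i, Nonempty (l.get i ≅ l'.get (σ i))

/-- The two conditions of the weak Jordan-Hölder property, for the given class `X`: every object
has an `X`-filtration, and the `X`-filtrations of minimal length of a given object are
isomorphic. -/
def IsWeakJordanHolderFor : Prop :=
  (∀ M : C, Filt conf X M) ∧
    ∀ (M : C) (l l' : List C), HasFiltration conf X l M → HasFiltration conf X l' M →
      l.length = filtLength conf X M → l'.length = filtLength conf X M → SeqIso l l'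

/-- The Jordan-Hölder property (JHP) of a category with the class `conf` of conflations: for some
class `X` of objects, the weak Jordan-Hölder conditions hold and moreover all
`X`-filtrations of a given object have the same length. -/
def JordanHolderProperty : Prop :=
  ∃ X : ObjectProperty C, IsWeakJordanHolderFor conf X ∧
    ∀ (M : C) (l l' : List C), HasFiltration conf X l M → HasFiltration conf X l' M →
      l.length = l'.length

end Filtration

/-! ### Semibricks -/

section Semibrick

variable {C : Type u} [Category.{v} C] [Preadditive C]

/-- A brick: an object whose endomorphism ring is a division ring. -/
def IsBrick (M : C) : Prop :=
  Nontrivial (End M) ∧ ∀ f : End M, f ≠ 0 → IsUnit f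

/-- A semibrick: a class of bricks with no nonzero morphism between non-isomorphic members.
A set of isomorphism classes may be given by any class of objects representing it. -/
def IsSemibrick (X : ObjectProperty C) : Prop :=
  (∀ M, X M → IsBrick M) ∧
    ∀ M N, X M → X N → ¬ Nonempty (M ≅ N) → ∀ f : M ⟶ N, f = 0

/-- A semibrick `X` is proper if there is no conflation `M ⟶ 0 ⟶ N` with `M` in `X` and `N` in
the filtration subcategory generated by `X`. -/
def IsProperSemibrick (conf : ObjectProperty (ShortComplex C)) (X : ObjectProperty C) : Prop :=
  IsSemibrick X ∧ ∀ S : ShortComplex C, conf S → X S.X₁ → IsZero S.X₂ → ¬ Filt conf X S.X₃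

end Semibrick

end SemibrickJHP

namespace SemibrickJHP

/-! ### Conflations in an exact category -/

namespace ExactStructure

variable {C : Type u} [Category.{v} C] [Preadditive C] (ℰ : ExactStructure C)

section

variable {ℰ} {A B D : C} {i : A ⟶ B} {p : B ⟶ D} {w : i ≫ p = 0}

/-! The class `X` itself witnesses (JHP): filtrations by a semibrick have unique cones, even without
assuming minimal length. The key is `HasFiltration.exists_conflation`: a nonzero map `f` from a
filtered `M` to a member `S` is a deflation, and its kernel is filtered by the cones of `M` with one
copy of `S` removed. This goes by induction on the filtration. If `f` kills `M'`, it factors through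
the top cone by a map that Schur's lemma makes invertible. Otherwise `f` restricted to `M'` is a
deflation by induction, and `exists_conflation_of_restriction` extends this to `M`, adding the top
cone to the kernel. Applied to the last deflation of a second filtration of `M`, this gives two
filtrations of its kernel, and `HasFiltration.permIso` follows by induction. Properness is
immediate: inflations are monic, so `X ⟶ 0` being one would force a brick to vanish. -/

lemma mono_of_conflation (h : ℰ.conflation (.mk i p w)) : Mono i := by
  obtain ⟨⟨hi⟩, -⟩ := ℰ.isKernelCokernelPair h
  exact Fork.IsLimit.mono hi

lemma epi_of_conflation (h : ℰ.conflation (.mk i p w)) : Epi p := by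
  obtain ⟨-, ⟨hp⟩⟩ := ℰ.isKernelCokernelPair h
  exact Cofork.IsColimit.epi hp

lemma exists_lift_of_conflation (h : ℰ.conflation (.mk i p w)) {T : C} (t : T ⟶ B)
    (ht : t ≫ p = 0) : ∃ s : T ⟶ A, s ≫ i = t := by
  obtain ⟨⟨hi⟩, -⟩ := ℰ.isKernelCokernelPair h
  obtain ⟨s, hs⟩ := KernelFork.IsLimit.lift' hi t ht
  exact ⟨s, hs⟩

lemma exists_desc_of_conflation (h : ℰ.conflation (.mk i p w)) {T : C} (t : B ⟶ T)
    (ht : i ≫ t = 0) : ∃ s : D ⟶ T, p ≫ s = t := by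
  obtain ⟨-, ⟨hp⟩⟩ := ℰ.isKernelCokernelPair h
  obtain ⟨s, hs⟩ := CokernelCofork.IsColimit.desc' hp t ht
  exact ⟨s, hs⟩

/-- Replacing the three terms of a conflation by isomorphic objects yields a conflation. -/
lemma conflation_congr (h : ℰ.conflation (.mk i p w)) {A' B' D' : C} (a : A ≅ A') (b : B ≅ B')
    (d : D ≅ D') {i' : A' ⟶ B'} {p' : B' ⟶ D'} (w' : i' ≫ p' = 0)
    (hi : a.hom ≫ i' = i ≫ b.hom) (hp : b.hom ≫ p' = p ≫ d.hom) :
    ℰ.conflation (.mk i' p' w') :=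
  ℰ.of_iso (ShortComplex.isoMk a b d hi hp) h

end

/-- A deflation together with any kernel of it is a conflation. -/
lemma conflation_of_isKernel {A B D : C} {i : A ⟶ B} {p : B ⟶ D} (w : i ≫ p = 0)
    (hp : IsDeflation ℰ.conflation p) (hi : Mono i)
    (hlift : ∀ {T : C} (t : T ⟶ B), t ≫ p = 0 → ∃ s : T ⟶ A, s ≫ i = t) :
    ℰ.conflation (.mk i p w) := by
  obtain ⟨A', i', w', h⟩ := hp
  have := mono_of_conflation h
  obtain ⟨s, hs⟩ := hlift i' w'
  obtain ⟨t, ht⟩ := exists_lift_of_conflation h i w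
  let e : A' ≅ A :=
    { hom := s
      inv := t
      hom_inv_id := by simp [← cancel_mono i', ht, hs]
      inv_hom_id := by simp [← cancel_mono i, ht, hs] }
  exact conflation_congr h e (Iso.refl _) (Iso.refl _) w (by simp [e, hs]) (by simp)

/-- Pullbacks are unique up to isomorphism, so the single one supplied by the axiom suffices. -/
lemma isDeflation_of_isPullback {P B D D' : C} {b : P ⟶ B} {q : P ⟶ D'} {p : B ⟶ D} {d : D' ⟶ D}
    (sq : IsPullback b q p d) (hp : IsDeflation ℰ.conflation p) :
    IsDeflation ℰ.conflation q := by
  obtain ⟨P', b', q', sq', A, i, w, h⟩ := ℰ.deflation_pullback p d hp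
  let e := sq'.isoIsPullback _ _ sq
  have he : e.hom ≫ q = q' := sq'.isoIsPullback_hom_snd _ _ sq
  have w' : (i ≫ e.hom) ≫ q = 0 := by rw [Category.assoc, he, w]
  exact ⟨A, i ≫ e.hom, w',
    conflation_congr h (Iso.refl _) e (Iso.refl _) w' (by simp) (by simp [he])⟩

lemma exists_conflation_id_right {M : C} [HasZeroObject C] :
    ∃ (Z : C) (_ : IsZero Z) (i : Z ⟶ M) (w : i ≫ 𝟙 M = 0), ℰ.conflation (.mk i (𝟙 M) w) := by
  obtain ⟨Z, i, w, h⟩ := ℰ.deflation_id M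
  have := mono_of_conflation h
  have hi : i = 0 := by simpa using w
  exact ⟨Z, (IsZero.iff_id_eq_zero Z).2 (by simp [← cancel_mono i, hi]), i, w, h⟩

lemma isDeflation_of_isZero {M Z : C} (hZ : IsZero Z) (f : M ⟶ Z) :
    IsDeflation ℰ.conflation f := by
  obtain ⟨D, p, w, h⟩ := ℰ.inflation_id M
  have := epi_of_conflation h
  have hp : p = 0 := by simpa using w
  have hD : IsZero D := (IsZero.iff_id_eq_zero D).2 (by simp [← cancel_epi p, hp])
  exact ⟨M, 𝟙 M, hZ.eq_of_tgt _ _,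
    conflation_congr h (Iso.refl _) (Iso.refl _) (hD.iso hZ) _ (by simp) (hZ.eq_of_tgt _ _)⟩

open ZeroObject in
/-- The projections of a direct sum decomposition are deflations. -/
lemma isDeflation_of_decomposition [HasZeroObject C] {P Y S : C} {j : Y ⟶ P} {q : P ⟶ Y}
    {s : S ⟶ P} {r : P ⟶ S} (hj : j ≫ q = 𝟙 Y) (hs : s ≫ r = 𝟙 S) (hjr : j ≫ r = 0)
    (hsq : s ≫ q = 0) (hid : q ≫ j + r ≫ s = 𝟙 P) : IsDeflation ℰ.conflation r := by
  -- A product is a pullback over zero, so `r` is a base change of the deflation `Y ⟶ 0`.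
  have sq : IsPullback q r (0 : Y ⟶ 0) (0 : S ⟶ 0) :=
    ⟨⟨by simp⟩, ⟨PullbackCone.IsLimit.mk _ (fun c => c.fst ≫ j + c.snd ≫ s)
      (fun c => by simp [hj, hsq]) (fun c => by simp [hs, hjr])
      (fun c m h₁ h₂ => by
        rw [← Category.comp_id m, ← hid, ← h₁, ← h₂]
        simp)⟩⟩
  exact ℰ.isDeflation_of_isPullback sq (ℰ.isDeflation_of_isZero (isZero_zero C) _)

/-- A morphism to `S` whose restriction along an inflation is a deflation is itself a deflation,
and the cone of the inflation is also the cone of the induced morphism between the kernels. -/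
lemma exists_conflation_of_restriction [HasZeroObject C] {M' M Y K' S : C}
    {i : M' ⟶ M} {p : M ⟶ Y} {w : i ≫ p = 0} (h : ℰ.conflation (.mk i p w)) (f : M ⟶ S)
    {k : K' ⟶ M'} {wk : k ≫ i ≫ f = 0} (hk : ℰ.conflation (.mk k (i ≫ f) wk)) :
    ∃ (K : C) (κ : K ⟶ M) (wκ : κ ≫ f = 0) (a : K' ⟶ K) (wa : a ≫ κ ≫ p = 0),
      ℰ.conflation (.mk κ f wκ) ∧ ℰ.conflation (.mk a (κ ≫ p) wa) := by
  have := mono_of_conflation h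
  have := epi_of_conflation h
  have := mono_of_conflation hk
  have := epi_of_conflation hk
  -- `P` plays the role of `M / K'`. It contains `M' / K' = S` via `s`, with quotient `Y` via `q`;
  -- the map `r` induced by `f` splits `s`, so `P` is the direct sum of `Y` and `S`.
  obtain ⟨P, c, wc, hc⟩ := ℰ.inflation_comp k i ⟨_, _, _, hk⟩ ⟨_, _, _, h⟩
  have := epi_of_conflation hc
  obtain ⟨r, hr⟩ := exists_desc_of_conflation hc f (by simpa using wk)
  obtain ⟨q, hq⟩ := exists_desc_of_conflation hc p (by simp [w])
  obtain ⟨s, hs⟩ := exists_desc_of_conflation hk (i ≫ c) (by simpa using wc)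
  rw [Category.assoc] at hs
  have hsr : s ≫ r = 𝟙 S := by
    rw [← cancel_epi (i ≫ f), Category.assoc, reassoc_of% hs, hr, Category.comp_id]
  have hsq : s ≫ q = 0 := by
    rw [← cancel_epi (i ≫ f), Category.assoc, reassoc_of% hs, hq, w, comp_zero]
  -- The projection `𝟙 P - r ≫ s` away from `S` kills the image of `M'`, hence yields a section `j`
  -- of `q`.
  obtain ⟨j, hj⟩ := exists_desc_of_conflation h (c ≫ (𝟙 P - r ≫ s)) (by
    rw [Preadditive.comp_sub, Preadditive.comp_sub, reassoc_of% hr, hs, Category.comp_id, sub_self])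
  have hqj : q ≫ j = 𝟙 P - r ≫ s := by
    rw [← cancel_epi c, reassoc_of% hq, hj]
  have hjq : j ≫ q = 𝟙 Y := by
    rw [← cancel_epi p, ← hq, Category.assoc, reassoc_of% hqj]
    simp [hsq]
  have hjr : j ≫ r = 0 := by
    rw [← cancel_epi p, ← hq, Category.assoc, reassoc_of% hqj]
    simp [hsr]
  have hr' : IsDeflation ℰ.conflation r :=
    ℰ.isDeflation_of_decomposition hjq hsr hjr hsq (by rw [hqj]; simp)
  obtain ⟨K, κ, wκ, hκ⟩ : IsDeflation ℰ.conflation f :=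
    hr ▸ ℰ.deflation_comp c r ⟨_, _, _, hc⟩ hr'
  have := mono_of_conflation hκ
  obtain ⟨a, ha⟩ := exists_lift_of_conflation hκ (k ≫ i) (by simpa using wk)
  have wa : a ≫ κ ≫ p = 0 := by rw [reassoc_of% ha, w, comp_zero]
  refine ⟨K, κ, wκ, a, wa, hκ, ?_⟩
  have hlift (t : PullbackCone c j) : ∃ u, u ≫ κ = t.fst :=
    exists_lift_of_conflation hκ t.fst (by rw [← hr, reassoc_of% t.condition, hjr, comp_zero])
  choose lift hlift using hlift
  have hcomm : κ ≫ c = (κ ≫ p) ≫ j := by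
    rw [Category.assoc, hj, Preadditive.comp_sub, reassoc_of% hr, Preadditive.comp_sub,
      reassoc_of% wκ]
    simp
  -- The kernel of `f = c ≫ r` is the preimage under `c` of the summand `Y = ker r`, so `κ ≫ p` is a
  -- base change of `c`.
  have sq : IsPullback κ (κ ≫ p) c j :=
    ⟨⟨hcomm⟩, ⟨PullbackCone.IsLimit.mk _ lift hlift
      (fun t => by rw [reassoc_of% hlift t, ← hq, reassoc_of% t.condition, hjq, Category.comp_id])
      (fun t m h₁ _ => by rw [← cancel_mono κ, hlift, h₁])⟩⟩
  refine ℰ.conflation_of_isKernel wa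
    (ℰ.isDeflation_of_isPullback sq ⟨_, _, _, hc⟩) ?_ fun t ht => ?_
  · have : Mono (a ≫ κ) := by rw [ha]; infer_instance
    exact mono_of_mono a κ
  · obtain ⟨t', ht'⟩ := exists_lift_of_conflation h (t ≫ κ) (by simpa using ht)
    obtain ⟨u, hu⟩ := exists_lift_of_conflation hk t' (by
      rw [reassoc_of% ht', wκ, comp_zero])
    exact ⟨u, by rw [← cancel_mono κ, Category.assoc, ha, reassoc_of% hu, ht']⟩

end ExactStructure

/-! ### Bricks and semibricks -/

section Semibrick

variable {C : Type u} [Category.{v} C] [Preadditive C] {X : ObjectProperty C}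

lemma IsBrick.not_isZero {M : C} (hM : IsBrick M) : ¬ IsZero M := fun h => by
  have := hM.1
  exact zero_ne_one (α := End M) (h.eq_of_src _ _)

lemma IsBrick.isIso_of_ne_zero {M : C} (hM : IsBrick M) {f : M ⟶ M} (hf : f ≠ 0) : IsIso f :=
  (isUnit_iff_isIso f).1 (hM.2 f hf)

/-- Schur's lemma for a semibrick. -/
lemma IsSemibrick.isIso_of_ne_zero (hX : IsSemibrick X) {M N : C} (hM : X M) (hN : X N)
    {f : M ⟶ N} (hf : f ≠ 0) : IsIso f := by
  by_cases h : Nonempty (M ≅ N)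
  · obtain ⟨e⟩ := h
    have : IsIso (f ≫ e.inv) := (hX.1 M hM).isIso_of_ne_zero fun h0 => hf (by
      rw [← cancel_mono e.inv, h0, zero_comp])
    exact IsIso.of_isIso_comp_right f e.inv
  · exact absurd (hX.2 M N hM hN h f) hf

end Semibrick

/-! ### Uniqueness of filtrations by a semibrick -/

section Filtration

variable {C : Type u} [Category.{v} C]

/-- Two lists of objects agree up to permutation and isomorphism of their terms. -/
def PermIso (l l' : List C) : Prop :=
  (l.map (Quotient.mk (isIsomorphicSetoid C))).Perm (l'.map (Quotient.mk (isIsomorphicSetoid C)))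

lemma PermIso.seqIso {l l' : List C} (h : PermIso l l') : SeqIso l l' := by
  classical
  have h' : (l.map (Quotient.mk (isIsomorphicSetoid C))).Perm
    (l'.map (Quotient.mk (isIsomorphicSetoid C))) := h
  let σ : Fin (l.map (Quotient.mk (isIsomorphicSetoid C))).length ≃
      Fin (l'.map (Quotient.mk (isIsomorphicSetoid C))).length :=
    { toFun := h'.idxBij
      invFun := h'.symm.idxBij
      left_inv := h'.symm.idxBij_leftInverse_idxBij_symm
      right_inv := h'.symm.idxBij_rightInverse_idxBij_symm }
  refine ⟨(finCongr (by simp)).trans (σ.trans (finCongr (by simp))), fun i => ?_⟩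
  have hi := h'.getElem_idxBij_eq_getElem (Fin.cast (by simp) i)
  simp only [List.getElem_map, Fin.val_cast] at hi
  exact Quotient.exact (s := isIsomorphicSetoid C) hi.symm

lemma PermIso.length_eq {l l' : List C} (h : PermIso l l') : l.length = l'.length := by
  simpa using List.Perm.length_eq h

lemma PermIso.of_map_obj {T : ObjectProperty C} {l l' : List T.FullSubcategory}
    (h : PermIso (l.map (·.obj)) (l'.map (·.obj))) : SeqIso l l' := by
  obtain ⟨σ, hσ⟩ := h.seqIso
  refine ⟨(finCongr (by simp)).trans (σ.trans (finCongr (by simp))), fun i => ?_⟩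
  obtain ⟨e⟩ := hσ (Fin.cast (by simp) i)
  exact ⟨T.isoMk ((eqToIso (by simp)).trans (e.trans (eqToIso (by simp))))⟩

variable [Preadditive C] {ℰ : ExactStructure C} {X : ObjectProperty C}

lemma HasFiltration.of_iso {l : List C} {M N : C} (h : HasFiltration ℰ.conflation X l M)
    (e : M ≅ N) : HasFiltration ℰ.conflation X l N := by
  cases h with
  | zero hM => exact .zero (hM.of_iso e.symm)
  | step i p w h hY hM' =>
    have w' : (i ≫ e.hom) ≫ e.inv ≫ p = 0 := by simp [w]
    exact .step _ _ w' (ExactStructure.conflation_congr h (Iso.refl _) e (Iso.refl _) w'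
      (by simp) (by simp)) hY hM'

/-- A filtration of an object inside a full subcategory is one in the ambient category. -/
lemma HasFiltration.map_obj {T : ObjectProperty C} {l : List T.FullSubcategory}
    {M : T.FullSubcategory}
    (h : HasFiltration (inducedConflation ℰ.conflation T) (X.inverseImage T.ι) l M) :
    HasFiltration ℰ.conflation X (l.map (·.obj)) M.obj := by
  induction h with
  | zero hM => exact .zero (T.ι.map_isZero hM)
  | step i p w h hY hM' ih =>
    exact .step i.hom p.hom (by simpa using congrArg (·.hom) w) h hY ih

theorem IsSemibrick.isProperSemibrick (hX : IsSemibrick X) :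
    IsProperSemibrick ℰ.conflation X := by
  refine ⟨hX, fun S hS h₁ h₂ _ => (hX.1 _ h₁).not_isZero ?_⟩
  have : Mono S.f := ExactStructure.mono_of_conflation (w := S.zero) hS
  exact IsZero.of_mono S.f h₂

variable [HasZeroObject C]

lemma filt_of_prop {M : C} (hM : X M) : Filt ℰ.conflation X M := by
  obtain ⟨Z, hZ, i, w, h⟩ := ℰ.exists_conflation_id_right (M := M)
  exact ⟨[M], .step i _ w h hM (.zero hZ)⟩

/-- A nonzero morphism from a filtered object to a member of the semibrick is a deflation,
whose kernel is filtered by the remaining cones. -/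
lemma HasFiltration.exists_conflation (hX : IsSemibrick X) {l : List C} {M : C}
    (hM : HasFiltration ℰ.conflation X l M) {S : C} (hS : X S) (f : M ⟶ S) (hf : f ≠ 0) :
    ∃ (K : C) (k : K ⟶ M) (w : k ≫ f = 0) (m : List C), ℰ.conflation (.mk k f w) ∧
      HasFiltration ℰ.conflation X m K ∧ PermIso l (S :: m) := by
  induction hM with
  | zero hM => exact absurd (hM.eq_of_src _ _) hf
  | @step l M' M Y i p w h hY hM' ih =>
    by_cases hif : i ≫ f = 0
    · obtain ⟨g, rfl⟩ := ExactStructure.exists_desc_of_conflation h f hif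
      have : IsIso g := hX.isIso_of_ne_zero hY hS fun h0 => hf (by simp [h0])
      refine ⟨M', i, hif, l, ExactStructure.conflation_congr h (Iso.refl _) (Iso.refl _) (asIso g)
        hif (by simp) (by simp), hM', ?_⟩
      have : (Quotient.mk (isIsomorphicSetoid C) Y) = Quotient.mk _ S :=
        Quotient.sound ⟨asIso g⟩
      simp [PermIso, this]
    · obtain ⟨K', k, wk, m, hk, hm, hl⟩ := ih (i ≫ f) hif
      obtain ⟨K, κ, wκ, a, wa, hκ, ha⟩ := ℰ.exists_conflation_of_restriction h f hk
      exact ⟨K, κ, wκ, Y :: m, hκ, .step a _ wa ha hY hm,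
        (List.Perm.cons _ hl).trans (List.Perm.swap _ _ _)⟩

/-- The cones of a filtration by a semibrick are unique up to permutation and isomorphism. -/
theorem HasFiltration.permIso (hX : IsSemibrick X) {l l' : List C} {M : C}
    (h : HasFiltration ℰ.conflation X l M) (h' : HasFiltration ℰ.conflation X l' M) :
    PermIso l l' := by
  induction h' generalizing l with
  | zero hM =>
    cases h with
    | zero => exact List.Perm.refl _
    | step i p w h hY =>
      have := ExactStructure.epi_of_conflation h
      exact absurd (IsZero.of_epi p hM) (hX.1 _ hY).not_isZero
  | @step l' M' M S i p w hc hS hM' ih =>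
    have := ExactStructure.epi_of_conflation hc
    have := ExactStructure.mono_of_conflation hc
    have hp : p ≠ 0 := fun h0 => (hX.1 _ hS).not_isZero (IsZero.of_epi_eq_zero p h0)
    obtain ⟨K, k, wk, m, hk, hm, hl⟩ := h.exists_conflation hX hS p hp
    have := ExactStructure.mono_of_conflation hk
    obtain ⟨s, hs⟩ := ExactStructure.exists_lift_of_conflation hc k wk
    obtain ⟨t, ht⟩ := ExactStructure.exists_lift_of_conflation hk i w
    -- Both objects are kernels of `p`.
    let e : K ≅ M' :=
      { hom := s
        inv := t
        hom_inv_id := by simp [← cancel_mono k, ht, hs]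
        inv_hom_id := by simp [← cancel_mono i, ht, hs] }
    exact hl.trans (List.Perm.cons _ (ih (hm.of_iso e)))

/-- Each stage of a filtration is itself filtered, and each cone has a filtration of length one, so
the whole filtration already lies in the subcategory. -/
lemma HasFiltration.filt_inducedConflation {l : List C} {M : C}
    (h : HasFiltration ℰ.conflation X l M) (hM : Filt ℰ.conflation X M) :
    Filt (inducedConflation ℰ.conflation (Filt ℰ.conflation X))
      (X.inverseImage (Filt ℰ.conflation X).ι) ⟨M, hM⟩ := by
  induction h with
  | zero hZ =>
    exact ⟨[], .zero ((IsZero.iff_id_eq_zero _).2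
      (ObjectProperty.hom_ext _ (hZ.eq_of_src _ _)))⟩
  | @step l M' M Y i p w h hY hM' ih =>
    obtain ⟨m, hm⟩ := ih ⟨l, hM'⟩
    let i' : (⟨M', l, hM'⟩ : (Filt ℰ.conflation X).FullSubcategory) ⟶ ⟨M, hM⟩ :=
      ObjectProperty.homMk i
    let p' : (⟨M, hM⟩ : (Filt ℰ.conflation X).FullSubcategory) ⟶ ⟨Y, filt_of_prop hY⟩ :=
      ObjectProperty.homMk p
    have w' : i' ≫ p' = 0 := ObjectProperty.hom_ext _ w
    exact ⟨_, .step i' p' w' h hY hm⟩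

theorem IsSemibrick.jordanHolderProperty (hX : IsSemibrick X) :
    JordanHolderProperty (inducedConflation ℰ.conflation (Filt ℰ.conflation X)) :=
  ⟨X.inverseImage (Filt ℰ.conflation X).ι,
    ⟨fun M => M.property.choose_spec.filt_inducedConflation M.property,
      fun _ _ _ h h' _ _ => (h.map_obj.permIso hX h'.map_obj).of_map_obj⟩,
    fun _ _ _ h h' => by simpa using (h.map_obj.permIso hX h'.map_obj).length_eq⟩

end Filtration

end SemibrickJHP

theorem corollary3p11 {C : Type u} [Category.{v} C] [Preadditive C] [HasZeroObject C]
    [HasBinaryBiproducts C] (ℰ : SemibrickJHP.ExactStructure C) (X : ObjectProperty C)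
    (hX : SemibrickJHP.IsSemibrick X) :
    SemibrickJHP.IsProperSemibrick ℰ.conflation X ∧
      SemibrickJHP.JordanHolderProperty
        (SemibrickJHP.inducedConflation ℰ.conflation
          (SemibrickJHP.Filt ℰ.conflation X)) :=
  ⟨hX.isProperSemibrick, hX.jordanHolderProperty⟩
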